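/- All graphs are finite and simple. For an integer $k\ge 1$, a graph $G$ is $k$-critical if every proper subgraph of $G$ is $(k-1)$-colorable but $G$ itself is not. The circumference of a graph is the length of a longest cycle in it, and for integers $k\ge 4$ and $n\ge k+2$ we denote by $L_k(n)$ the largest integer $l$ such that every $k$-critical graph on $n$ vertices has circumference at least $l$. **Theorem.** For every integer $k\ge 4$ and every integer $n\ge k+2$, every $k$-critical graph on $n$ vertices has a cycle of length at least $\dfrac{\log n}{100\log k}$. In other words, $$L_k(n)\;\ge\;\frac{\log n}{100\log k}.$$ -/

import Mathlib

namespace SimpleGraph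

/-- `G` is `k`-critical (used for `1 ≤ k`): every proper subgraph of `G` is `(k-1)`-colorable,
but `G` itself is not. Subgraphs may omit vertices as well as edges. -/
def IsCritical {V : Type*} (G : SimpleGraph V) (k : ℕ) : Prop :=
  (∀ H : G.Subgraph, H ≠ ⊤ → H.coe.Colorable (k - 1)) ∧ ¬ G.Colorable (k - 1)

/-- The circumference of `G`: the length of a longest cycle of `G`
(the supremum of all cycle lengths, which is `0` if there is no cycle). -/
noncomputable def circumference {V : Type*} (G : SimpleGraph V) : ℕ∞ :=
  ⨆ (v : V) (c : G.Walk v v) (_ : c.IsCycle), (c.length : ℕ∞)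

/-- `L_k(n)`: the largest `l` such that every `k`-critical graph on `n` vertices has
circumference at least `l`. -/
noncomputable def minCriticalCircumference (k n : ℕ) : ℕ∞ :=
  sSup {l : ℕ∞ | ∀ G : SimpleGraph (Fin n), G.IsCritical k → l ≤ G.circumference}

end SimpleGraph

/-! The bound obtained is n ≤ k ^ l for some cycle length l; the factor 100 is slack. Treedepth
links the two quantities.

Long paths (`Linked.treeDepthLE`): a critical graph is connected without cut vertices, so for an
edge xy the whole vertex set is `Linked` between {x} and {y}. If all x–y paths have at most L
vertices, the treedepth is at most L. A longest x–y path, closed by xy, is the cycle.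

Few vertices (`TreeDepthLE.card_le`): for each vertex w choose a (k-1)-colouring proper away from w.
Two such colourings that agree on the boundary between two unrelated pieces could be spliced into a
proper colouring of G if their vertices w lay in different pieces. Branching on the colour of each
deleted vertex, treedepth t leaves room for at most 1 + (k-1) + ... + (k-1)^(t-1) vertices. -/

namespace SimpleGraph

variable {V : Type*} {G : SimpleGraph V}

/-! ### Walks and components inside a vertex set -/

/-- `v` can be reached from `u` by a walk of `G` that stays inside `S`. -/
def ReachIn (G : SimpleGraph V) (S : Set V) (u v : V) : Prop :=
  ∃ p : G.Walk u v, ∀ w ∈ p.support, w ∈ S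

namespace ReachIn

variable {S T : Set V} {u v w x y : V}

theorem refl (h : u ∈ S) : G.ReachIn S u u :=
  ⟨Walk.nil, by simpa using h⟩

theorem symm (h : G.ReachIn S u v) : G.ReachIn S v u := by
  obtain ⟨p, hp⟩ := h
  exact ⟨p.reverse, by simpa using hp⟩

theorem trans (h : G.ReachIn S u v) (h' : G.ReachIn S v w) : G.ReachIn S u w := by
  obtain ⟨p, hp⟩ := h
  obtain ⟨q, hq⟩ := h'
  refine ⟨p.append q, fun a ha => ?_⟩
  rcases Walk.mem_support_append_iff .. |>.1 ha with h | h
  exacts [hp a h, hq a h]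

theorem mono (hST : S ⊆ T) (h : G.ReachIn S u v) : G.ReachIn T u v := by
  obtain ⟨p, hp⟩ := h
  exact ⟨p, fun w hw => hST (hp w hw)⟩

theorem left_mem (h : G.ReachIn S u v) : u ∈ S := by
  obtain ⟨p, hp⟩ := h
  exact hp u p.start_mem_support

theorem right_mem (h : G.ReachIn S u v) : v ∈ S :=
  h.symm.left_mem

theorem cons (hu : u ∈ S) (huv : G.Adj u v) (h : G.ReachIn S v w) : G.ReachIn S u w := by
  obtain ⟨p, hp⟩ := h
  refine ⟨Walk.cons huv p, fun a ha => ?_⟩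
  rw [Walk.support_cons, List.mem_cons] at ha
  rcases ha with rfl | ha
  exacts [hu, hp a ha]

theorem head_induction {P : V → Prop} (h : G.ReachIn S u y) (base : y ∈ S → P y)
    (step : ∀ a b, a ∈ S → G.Adj a b → G.ReachIn S b y → P b → P a) : P u := by
  obtain ⟨p, hp⟩ := h
  induction p with
  | nil => exact base (hp _ (by simp))
  | cons hadj p ih =>
    have hp' : ∀ w ∈ p.support, w ∈ S := fun w hw => hp w (by simp [hw])
    exact step _ _ (hp _ (by simp)) hadj ⟨p, hp'⟩ (ih base step hp')

theorem avoid_or_through (d : V) (h : G.ReachIn S u y) :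
    G.ReachIn (S \ {d}) u y ∨ (G.ReachIn S u d ∧ G.ReachIn S d y) := by
  refine h.head_induction
    (P := fun u => G.ReachIn (S \ {d}) u y ∨ (G.ReachIn S u d ∧ G.ReachIn S d y))
    (fun hy => ?_) (fun a b ha hab hb ih => ?_)
  · by_cases hd : y = d
    · subst hd; exact Or.inr ⟨refl hy, refl hy⟩
    · exact Or.inl (refl ⟨hy, hd⟩)
  · by_cases hd : a = d
    · subst hd; exact Or.inr ⟨refl ha, cons ha hab hb⟩
    · rcases ih with h | ⟨h, hdy⟩
      · exact Or.inl (cons ⟨ha, hd⟩ hab h)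
      · exact Or.inr ⟨cons ha hab h, hdy⟩

/-- A walk that meets `x` meets one of `x`, `y` before the other. -/
theorem first_of_two (hxy : x ≠ y) (h : G.ReachIn S u x) :
    G.ReachIn (S \ {y}) u x ∨ G.ReachIn (S \ {x}) u y := by
  refine h.head_induction (P := fun u => G.ReachIn (S \ {y}) u x ∨ G.ReachIn (S \ {x}) u y)
    (fun hx => Or.inl (refl ⟨hx, hxy⟩)) (fun a b ha hab hb ih => ?_)
  by_cases hax : a = x
  · subst hax; exact Or.inl (refl ⟨ha, hxy⟩)
  by_cases hay : a = y
  · subst hay; exact Or.inr (refl ⟨ha, hax⟩)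
  exact ih.imp (cons ⟨ha, hay⟩ hab) (cons ⟨ha, hax⟩ hab)

theorem exists_adj (h : G.ReachIn S u x) (hu : u ≠ x) :
    ∃ a, G.Adj a x ∧ G.ReachIn (S \ {x}) u a := by
  refine h.head_induction (P := fun u => u ≠ x → ∃ a, G.Adj a x ∧ G.ReachIn (S \ {x}) u a)
    (fun _ h => absurd rfl h) (fun a b ha hab _ ih hax => ?_) hu
  by_cases hbx : b = x
  · subst hbx; exact ⟨a, hab, refl ⟨ha, hax⟩⟩
  · obtain ⟨c, hc, hbc⟩ := ih hbx
    exact ⟨c, hc, cons ⟨ha, hax⟩ hab hbc⟩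

end ReachIn

/-- The vertices that can be reached from `v` inside `S`. -/
def compIn (G : SimpleGraph V) (S : Set V) (v : V) : Set V :=
  {w | G.ReachIn S v w}

theorem compIn_subset {S : Set V} {v : V} : G.compIn S v ⊆ S :=
  fun _ h => h.right_mem

theorem compIn_sdiff_ssubset {S : Set V} {b v : V} (hb : b ∈ S) : G.compIn (S \ {b}) v ⊂ S :=
  ⟨compIn_subset.trans Set.sdiff_subset, fun h => (compIn_subset (h hb)).2 rfl⟩

theorem ReachIn.inter_compIn {S T : Set V} {u v w : V} (h : G.ReachIn T u w) (hTS : T ⊆ S)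
    (hv : G.ReachIn S v u) : G.ReachIn (T ∩ G.compIn S v) u w := by
  refine h.head_induction (P := fun a => G.ReachIn S v a → G.ReachIn (T ∩ G.compIn S v) a w)
    (fun hw h => .refl ⟨hw, h⟩) (fun a b ha hab hb ih hva => ?_) hv
  exact .cons ⟨ha, hva⟩ hab (ih (hva.trans (.cons (hTS ha) hab (.refl (hTS hb.left_mem)))))

/-! ### Treedepth -/

/-- The subgraph of `G` induced on a finite vertex set has treedepth at most the given number. -/
inductive TreeDepthLE (G : SimpleGraph V) : Set V → ℕ → Prop
  | empty (t : ℕ) : TreeDepthLE G ∅ t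
  | remove {D : Set V} {t : ℕ} (v : V) (hv : v ∈ D) (h : TreeDepthLE G (D \ {v}) t) :
      TreeDepthLE G D (t + 1)
  | union {A B : Set V} {t : ℕ} (hd : Disjoint A B) (hAB : ∀ a ∈ A, ∀ b ∈ B, ¬ G.Adj a b)
      (hA : TreeDepthLE G A t) (hB : TreeDepthLE G B t) : TreeDepthLE G (A ∪ B) t

namespace TreeDepthLE

theorem mono {D : Set V} {t s : ℕ} (h : G.TreeDepthLE D t) (hts : t ≤ s) :
    G.TreeDepthLE D s := by
  induction h generalizing s with
  | empty t => exact .empty s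
  | remove v hv _ ih =>
    obtain ⟨r, rfl⟩ : ∃ r, s = r + 1 := ⟨s - 1, by omega⟩
    exact .remove v hv (ih (by omega))
  | union hd hAB _ _ ihA ihB => exact .union hd hAB (ihA hts) (ihB hts)

theorem of_compIn [Finite V] {S : Set V} {t : ℕ}
    (h : ∀ v ∈ S, G.TreeDepthLE (G.compIn S v) t) : G.TreeDepthLE S t := by
  induction hn : S.ncard using Nat.strong_induction_on generalizing S with
  | _ n ih =>
    rcases S.eq_empty_or_nonempty with rfl | ⟨v, hv⟩
    · exact .empty t
    have key : ∀ u ∈ S \ G.compIn S v, G.compIn (S \ G.compIn S v) u = G.compIn S u := by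
      intro u hu
      ext w
      refine ⟨fun hw => hw.mono Set.sdiff_subset, fun hw => ?_⟩
      refine (ReachIn.inter_compIn hw subset_rfl (.refl hu.1)).mono ?_
      rintro a ⟨haS, ha⟩
      exact ⟨haS, fun hva => hu.2 (ReachIn.trans hva ha.symm)⟩
    have hlt : (S \ G.compIn S v).ncard < n := by
      rw [← hn]
      exact Set.ncard_lt_ncard ⟨Set.sdiff_subset, fun hs => (hs hv).2 (.refl hv)⟩
    have hrest := ih _ hlt (S := S \ G.compIn S v)
      (fun u hu => by rw [key u hu]; exact h u hu.1) rfl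
    have : G.TreeDepthLE (G.compIn S v ∪ S \ G.compIn S v) t :=
      (h v hv).union Set.disjoint_sdiff_right
      (fun a ha b hb hab => hb.2 (ReachIn.trans ha
        (.cons (compIn_subset ha) hab (.refl hb.1)))) hrest
    rwa [Set.union_sdiff_cancel compIn_subset] at this

/-- Hanging pairwise unrelated pieces `K b` on the vertices `b` of `B`. -/
theorem attach {B : Set V} {t s : ℕ} {K : V → Set V} (h : G.TreeDepthLE B t)
    (hK : ∀ b ∈ B, G.TreeDepthLE (K b) s) (hself : ∀ b ∈ B, b ∉ K b)
    (hsep : ∀ b ∈ B, ∀ b' ∈ B, b ≠ b' → ∀ u ∈ K b, ∀ w ∈ insert b' (K b'), u ≠ w ∧ ¬ G.Adj u w) :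
    G.TreeDepthLE (⋃ b ∈ B, insert b (K b)) (t + s) := by
  induction h with
  | empty t => simpa using TreeDepthLE.empty (t + s)
  | @remove D t v hv h ih =>
    have hsub : D \ {v} ⊆ D := Set.sdiff_subset
    have h1 := ih (fun b hb => hK b (hsub hb)) (fun b hb => hself b (hsub hb))
      (fun b hb b' hb' => hsep b (hsub hb) b' (hsub hb'))
    -- Once `v` is deleted, `K v` is unrelated to everything else, so its depth `s` is absorbed by
    -- `t + s`.
    have heq : (⋃ b ∈ D, insert b (K b)) \ {v} = (⋃ b ∈ D \ {v}, insert b (K b)) ∪ K v := by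
      ext x
      simp only [Set.mem_sdiff, Set.mem_iUnion, exists_prop, Set.mem_singleton_iff, Set.mem_union]
      constructor
      · rintro ⟨⟨b, hb, hx⟩, hxv⟩
        by_cases hbv : b = v
        · subst hbv
          exact .inr (hx.resolve_left hxv)
        · exact .inl ⟨b, ⟨hb, hbv⟩, hx⟩
      · rintro (⟨b, ⟨hb, hbv⟩, hx⟩ | hx)
        · refine ⟨⟨b, hb, hx⟩, ?_⟩
          rcases hx with rfl | hx
          · exact hbv
          · exact (hsep b hb v hv hbv x hx v (.inl rfl)).1
        · exact ⟨⟨v, hv, .inr hx⟩, fun e => hself v hv (e ▸ hx)⟩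
    have key : ∀ x ∈ ⋃ b ∈ D \ {v}, insert b (K b), ∀ y ∈ K v, y ≠ x ∧ ¬ G.Adj y x := by
      intro x hx y hy
      simp only [Set.mem_iUnion, exists_prop] at hx
      obtain ⟨b, hb, hx⟩ := hx
      exact hsep v hv b hb.1 (fun e => hb.2 e.symm) y hy x hx
    rw [show t + 1 + s = (t + s) + 1 by omega]
    refine .remove v (Set.mem_biUnion hv (.inl rfl)) ?_
    rw [heq]
    exact .union (Set.disjoint_left.2 fun x hx hy => (key x hx x hy).1 rfl)
      (fun x hx y hy h => (key x hx y hy).2 h.symm) h1 ((hK v hv).mono (by omega))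
  | @union A B t hd hAB hA hB ihA ihB =>
    have h1 := ihA (fun b hb => hK b (.inl hb)) (fun b hb => hself b (.inl hb))
      (fun b hb b' hb' => hsep b (.inl hb) b' (.inl hb'))
    have h2 := ihB (fun b hb => hK b (.inr hb)) (fun b hb => hself b (.inr hb))
      (fun b hb b' hb' => hsep b (.inr hb) b' (.inr hb'))
    have key : ∀ x ∈ ⋃ b ∈ A, insert b (K b), ∀ y ∈ ⋃ b ∈ B, insert b (K b),
        x ≠ y ∧ ¬ G.Adj x y := by
      intro x hx y hy
      simp only [Set.mem_iUnion, exists_prop] at hx hy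
      obtain ⟨a, ha, hx⟩ := hx
      obtain ⟨b, hb, hy⟩ := hy
      have hab : a ≠ b := fun e => Set.disjoint_left.1 hd ha (e ▸ hb)
      rcases hx with rfl | hx
      · rcases hy with rfl | hy
        · exact ⟨hab, hAB _ ha _ hb⟩
        · have := hsep b (.inr hb) x (.inl ha) hab.symm y hy x (.inl rfl)
          exact ⟨this.1.symm, fun h => this.2 h.symm⟩
      · exact hsep a (.inl ha) b (.inr hb) hab x hx y hy
    rw [Set.biUnion_union]
    exact .union (Set.disjoint_left.2 fun x hx hy => (key x hx x hy).1 rfl)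
      (fun x hx y hy => (key x hx y hy).2) h1 h2

end TreeDepthLE

/-! ### Linked sets, cores and what hangs on them -/

/-- `D` is connected, `X` and `Y` are nonempty subsets of it, and no vertex of `D` separates
another one from `X ∪ Y` within `D`. -/
structure Linked (G : SimpleGraph V) (D X Y : Set V) : Prop where
  left_nonempty : X.Nonempty
  right_nonempty : Y.Nonempty
  left_subset : X ⊆ D
  right_subset : Y ⊆ D
  reachIn : ∀ u ∈ D, ∀ v ∈ D, G.ReachIn D u v
  exists_reachIn : ∀ d ∈ D, ∀ v ∈ D, v ≠ d → ∃ z ∈ X ∪ Y, G.ReachIn (D \ {d}) v z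

/-- A walk that avoids `d` and leaves this component must do so through `b`, hence passes a
neighbour of `b` just before. So reaching `b` is as good as reaching the second terminal set. This
feeds both inductive steps of `Linked.treeDepthLE`. -/
theorem linked_compIn {D Z : Set V} {b v : V} (hconn : ∀ u ∈ D, ∀ v ∈ D, G.ReachIn D u v)
    (hb : b ∈ D) (hv : v ∈ D \ {b}) (hZ : ∃ z ∈ Z, G.ReachIn (D \ {b}) v z)
    (h : ∀ d ∈ G.compIn (D \ {b}) v, ∀ u ∈ G.compIn (D \ {b}) v, u ≠ d →
      (∃ z ∈ Z, G.ReachIn (D \ {d}) u z) ∨ G.ReachIn (D \ {d}) u b) :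
    G.Linked (G.compIn (D \ {b}) v) (Z ∩ G.compIn (D \ {b}) v)
      {u | u ∈ G.compIn (D \ {b}) v ∧ G.Adj u b} where
  left_nonempty := by
    obtain ⟨z, hz, hvz⟩ := hZ
    exact ⟨z, hz, hvz⟩
  right_nonempty := by
    obtain ⟨a, ha, hva⟩ := (hconn v hv.1 b hb).exists_adj hv.2
    exact ⟨a, hva, ha⟩
  left_subset := Set.inter_subset_right
  right_subset := fun _ h => h.1
  reachIn := fun u hu w hw =>
    (ReachIn.inter_compIn (ReachIn.trans hu.symm hw) subset_rfl hu).mono Set.inter_subset_right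
  exists_reachIn := by
    intro d hd u hu hud
    have restrict : ∀ w, G.ReachIn ((D \ {d}) \ {b}) u w →
        G.ReachIn (G.compIn (D \ {b}) v \ {d}) u w := by
      intro w hw
      refine (ReachIn.inter_compIn hw (S := D \ {b}) (fun a ha => ⟨ha.1.1, ha.2⟩) hu).mono ?_
      exact fun a ha => ⟨ha.2, ha.1.1.2⟩
    have hub : u ≠ b := (compIn_subset hu).2
    have through : G.ReachIn (D \ {d}) u b →
        ∃ z ∈ Z ∩ G.compIn (D \ {b}) v ∪ {u | u ∈ G.compIn (D \ {b}) v ∧ G.Adj u b},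
          G.ReachIn (G.compIn (D \ {b}) v \ {d}) u z := by
      intro h
      obtain ⟨a, ha, hua⟩ := h.exists_adj hub
      have := restrict a hua
      exact ⟨a, .inr ⟨this.right_mem.1, ha⟩, this⟩
    rcases h d hd u hu hud with ⟨z, hz, huz⟩ | h
    · rcases huz.avoid_or_through b with h' | ⟨h', -⟩
      · have := restrict z h'
        exact ⟨z, .inl ⟨hz, this.right_mem.1⟩, this⟩
      · exact through h'
    · exact through h

/-- The vertices of `D` that no other vertex separates from `Y`. -/
def core (G : SimpleGraph V) (D Y : Set V) : Set V :=
  {v | v ∈ D ∧ ∀ d ∈ D, d ≠ v → ∃ y ∈ Y, G.ReachIn (D \ {d}) v y}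

/-- The vertices of `D` that `d` separates from `Y`. -/
def hanging (G : SimpleGraph V) (D Y : Set V) (d : V) : Set V :=
  {v | v ∈ D ∧ v ≠ d ∧ ∀ y ∈ Y, ¬ G.ReachIn (D \ {d}) v y}

theorem hanging_of_reachIn {D Y : Set V} {d u v : V} (hu : u ∈ G.hanging D Y d)
    (h : G.ReachIn (D \ {d}) u v) : v ∈ G.hanging D Y d :=
  ⟨h.right_mem.1, h.right_mem.2, fun y hy hvy => hu.2.2 y hy (h.trans hvy)⟩

theorem hanging_of_adj {D Y : Set V} {d u v : V} (hu : u ∈ G.hanging D Y d)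
    (h : G.Adj u v) (hv : v ∈ D) (hvd : v ≠ d) : v ∈ G.hanging D Y d :=
  hanging_of_reachIn hu (.cons ⟨hu.1, hu.2.1⟩ h (.refl ⟨hv, hvd⟩))

theorem not_mem_hanging_of_mem_core {D Y : Set V} {b d : V} (hb : b ∈ G.core D Y) (hd : d ∈ D) :
    b ∉ G.hanging D Y d := by
  intro h
  obtain ⟨y, hy, hby⟩ := hb.2 d hd h.2.1.symm
  exact h.2.2 y hy hby

theorem subset_core {D Y : Set V} (hY : Y ⊆ D) : Y ⊆ G.core D Y :=
  fun y hy => ⟨hY hy, fun _ _ hd => ⟨y, hy, .refl ⟨hY hy, hd.symm⟩⟩⟩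

/-- A walk from `v` to `b` meets one of `b`, `b'` first; being in the core, that one continues to
`Y` avoiding the other. -/
theorem eq_of_mem_hanging {D Y : Set V} {b b' v : V}
    (hconn : ∀ u ∈ D, ∀ v ∈ D, G.ReachIn D u v) (hb : b ∈ G.core D Y) (hb' : b' ∈ G.core D Y)
    (hv : v ∈ G.hanging D Y b) (hv' : v ∈ G.hanging D Y b') : b = b' := by
  by_contra hne
  rcases (hconn v hv.1 b hb.1).first_of_two hne with h | h
  · obtain ⟨y, hy, hby⟩ := hb.2 b' hb'.1 (Ne.symm hne)
    exact hv'.2.2 y hy (h.trans hby)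
  · obtain ⟨y, hy, hby⟩ := hb'.2 b hb.1 hne
    exact hv.2.2 y hy (h.trans hby)

theorem hanging_ssubset {D Y : Set V} {d e : V} (hconn : ∀ u ∈ D, ∀ v ∈ D, G.ReachIn D u v)
    (hY : Y ⊆ D) (hY' : Y.Nonempty) (hd : d ∈ G.hanging D Y e) :
    G.hanging D Y d ⊂ G.hanging D Y e := by
  have hed : e ∉ G.hanging D Y d := by
    intro h
    obtain ⟨y, hy⟩ := hY'
    rcases (hconn y (hY hy) d hd.1).first_of_two hd.2.1 with h' | h'
    · exact hd.2.2 y hy h'.symm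
    · exact h.2.2 y hy h'.symm
  refine ⟨fun u hu => ⟨hu.1, fun h => hed (h ▸ hu), fun y hy huy => ?_⟩,
    fun h => (h hd).2.1 rfl⟩
  rcases huy.avoid_or_through d with h | ⟨-, h⟩
  · exact hu.2.2 y hy (h.mono fun a ha => ⟨ha.1.1, ha.2⟩)
  · exact hd.2.2 y hy h

/-- Among the vertices separating `v` from `Y`, one with the largest hanging set is in the core, by
`hanging_ssubset`. -/
theorem exists_core_of_mem [Finite V] {D Y : Set V} {v : V}
    (hconn : ∀ u ∈ D, ∀ v ∈ D, G.ReachIn D u v)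
    (hY : Y ⊆ D) (hY' : Y.Nonempty) (hv : v ∈ D) :
    ∃ b ∈ G.core D Y, v ∈ insert b (G.hanging D Y b) := by
  by_cases hvc : v ∈ G.core D Y
  · exact ⟨v, hvc, .inl rfl⟩
  have hne : {d | d ∈ D ∧ v ∈ G.hanging D Y d}.Nonempty := by
    simp only [core, Set.mem_ofPred_eq, not_and, not_forall] at hvc
    obtain ⟨d, hd, hdv, h⟩ := hvc hv
    exact ⟨d, hd, hv, Ne.symm hdv, fun y hy hvy => h ⟨y, hy, hvy⟩⟩
  obtain ⟨d, hd, hmax⟩ := Set.exists_max_image _ (fun d => (G.hanging D Y d).ncard)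
    (Set.toFinite _) hne
  refine ⟨d, ⟨hd.1, fun e he hed => ?_⟩, .inr hd.2⟩
  by_contra hcon
  have hde : d ∈ G.hanging D Y e :=
    ⟨hd.1, Ne.symm hed, fun y hy h => hcon ⟨y, hy, h⟩⟩
  have hss := hanging_ssubset hconn hY hY' hde
  exact absurd (hmax e ⟨he, hss.1 hd.2⟩) (not_le.2 (Set.ncard_lt_ncard hss))

/-- Walks ending in the core are projected to the core. -/
theorem ReachIn.to_core [Finite V] {D Y T : Set V} {b v y : V}
    (hconn : ∀ u ∈ D, ∀ v ∈ D, G.ReachIn D u v)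
    (hY : Y ⊆ D) (hY' : Y.Nonempty) (hTD : T ⊆ D) (hy : y ∈ G.core D Y)
    (hT : ∀ b ∈ G.core D Y, ∀ w ∈ G.hanging D Y b, G.ReachIn T w y → b ∈ T)
    (h : G.ReachIn T v y) (hb : b ∈ G.core D Y) (hv : v ∈ insert b (G.hanging D Y b)) :
    G.ReachIn (T ∩ G.core D Y) b y := by
  -- Each vertex of the walk is replaced by the core vertex it equals or hangs on; the walk changes
  -- core vertex only along an edge of the core.
  refine h.head_induction (P := fun v => ∀ b ∈ G.core D Y, v ∈ insert b (G.hanging D Y b) →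
    G.ReachIn (T ∩ G.core D Y) b y) (fun hyT b hb hyb => ?_) (fun a c ha hac hcy ih b hb hab => ?_)
    b hb hv
  · rcases hyb with rfl | hyb
    · exact .refl ⟨hyT, hb⟩
    · exact absurd hyb (not_mem_hanging_of_mem_core hy hb.1)
  · obtain ⟨b', hb', hc⟩ := exists_core_of_mem hconn hY hY' (hTD hcy.left_mem)
    have hr := ih b' hb' hc
    by_cases hbb : b = b'
    · exact hbb ▸ hr
    have hbT : b ∈ T := by
      rcases hab with rfl | hab
      · exact ha
      · exact hT b hb a hab (.cons ha hac hcy)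
    rcases hab with rfl | hab
    · rcases hc with rfl | hc
      · exact .cons ⟨hbT, hb⟩ hac hr
      · exact absurd (hanging_of_adj hc hac.symm hb.1 hbb)
          (not_mem_hanging_of_mem_core hb hb'.1)
    · by_cases hcb : c = b
      · exact ih b hb (.inl hcb)
      · exact ih b hb (.inr (hanging_of_adj hab hac (hTD hcy.left_mem) hcb))

theorem linked_core [Finite V] {D Y : Set V} {z : V} (hconn : ∀ u ∈ D, ∀ v ∈ D, G.ReachIn D u v)
    (hY : Y ⊆ D) (hY' : Y.Nonempty) (hz : z ∈ G.core D Y) :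
    G.Linked (G.core D Y) {z} Y where
  left_nonempty := ⟨z, rfl⟩
  right_nonempty := hY'
  left_subset := by simpa using hz
  right_subset := subset_core hY
  reachIn := fun u hu v hv =>
    (ReachIn.to_core hconn hY hY' subset_rfl hv (fun b hb _ _ _ => hb.1) (hconn u hu.1 v hv.1) hu
      (.inl rfl)).mono Set.inter_subset_right
  exists_reachIn := by
    intro d hd v hv hvd
    obtain ⟨y, hy, hvy⟩ := hv.2 d hd.1 (Ne.symm hvd)
    refine ⟨y, .inr hy, (ReachIn.to_core hconn hY hY' Set.sdiff_subset (subset_core hY hy) ?_ hvy hv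
      (.inl rfl)).mono fun a ha => ⟨ha.2, ha.1.2⟩⟩
    intro b hb w hw hwy
    refine ⟨hb.1, fun hbd => ?_⟩
    rw [Set.mem_singleton_iff] at hbd
    subst hbd
    exact hw.2.2 y hy hwy

/-! ### Long paths from large treedepth -/

theorem Walk.IsPath.append_cons {a b c d : V} {p : G.Walk a b} {q : G.Walk c d}
    (hp : p.IsPath) (hq : q.IsPath) (h : G.Adj b c)
    (hd : ∀ x ∈ p.support, x ∉ q.support) : (p.append (.cons h q)).IsPath := by
  rw [Walk.isPath_def, Walk.support_append, Walk.support_cons, List.tail_cons,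
    List.nodup_append]
  exact ⟨hp.support_nodup, hq.support_nodup, fun x hx y hy e => hd x hx (e ▸ hy)⟩

/-- If every path from `X` to `Y` in `D` has at most `L` vertices, then `D` has treedepth at
most `L`. -/
theorem Linked.treeDepthLE [Finite V] {D X Y : Set V} {L : ℕ} (hD : G.Linked D X Y)
    (hL : ∀ x ∈ X, ∀ y ∈ Y, ∀ p : G.Walk x y, p.IsPath → (∀ w ∈ p.support, w ∈ D) →
      p.length < L) : G.TreeDepthLE D L := by
  classical
  induction hn : D.ncard using Nat.strong_induction_on generalizing D X Y L with
  | _ n ih =>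
  subst hn
  have hconn := hD.reachIn
  have hY := hD.right_subset
  have hY' := hD.right_nonempty
  by_cases hcore : ∀ v ∈ D, v ∈ G.core D Y
  · obtain ⟨z, hz⟩ := hD.left_nonempty
    have hzD := hD.left_subset hz
    obtain ⟨M, rfl⟩ : ∃ M, L = M + 1 := by
      obtain ⟨y, hy⟩ := hY'
      obtain ⟨p, hp⟩ := hconn z hzD y (hY hy)
      have := hL z hz y hy p.bypass p.bypass_isPath
        (fun w hw => hp w (p.support_bypass_subset_support hw))
      exact ⟨L - 1, by omega⟩
    -- Nothing hangs, so each component of `D \ {z}` is linked from `Y` to the neighbours of `z`.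
    -- Appending `z` to a path there gives a `Y`–`X` path with one more vertex.
    refine .remove z hzD (.of_compIn fun v hv => ?_)
    have hlink : G.Linked (G.compIn (D \ {z}) v) (Y ∩ G.compIn (D \ {z}) v)
        {u | u ∈ G.compIn (D \ {z}) v ∧ G.Adj u z} := by
      refine linked_compIn hconn hzD hv ((hcore v hv.1).2 z hzD (Ne.symm hv.2)) ?_
      intro d hd u hu hud
      exact .inl ((hcore u (compIn_subset hu).1).2 d (compIn_subset hd).1 (Ne.symm hud))
    refine ih _ (Set.ncard_lt_ncard (compIn_sdiff_ssubset hzD)) hlink ?_ rfl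
    intro y hy a ha p hp hpD
    have hzp : z ∉ p.support := fun h => (compIn_subset (hpD z h)).2 rfl
    have := hL z hz y hy.1 (p.concat ha.2).reverse (hp.concat hzp ha.2).reverse ?_
    · simpa using this
    · intro w hw
      simp only [Walk.support_reverse, List.mem_reverse, Walk.support_concat,
        List.mem_append, List.mem_singleton] at hw
      rcases hw with hw | rfl
      · exact (compIn_subset (hpD w hw)).1
      · exact hzD
  · push Not at hcore
    obtain ⟨v₀, hv₀, hv₀c⟩ := hcore
    have hlt : (G.core D Y).ncard < D.ncard :=
      Set.ncard_lt_ncard ⟨fun v hv => hv.1, fun h => hv₀c (h hv₀)⟩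
    have hex : ∃ t, G.TreeDepthLE (G.core D Y) t := by
      obtain ⟨y, hy⟩ := hY'
      refine ⟨Nat.card V, ih _ hlt (linked_core hconn hY ⟨y, hy⟩ (subset_core hY hy)) ?_ rfl⟩
      intro x _ y _ p hp _
      have := Fintype.ofFinite V
      rw [Nat.card_eq_fintype_card]
      exact hp.length_lt
    have hmin := fun m => Nat.find_min hex (m := m)
    have hspec := Nat.find_spec hex
    set t := Nat.find hex
    -- `t` is the exact treedepth of the core. Were all core paths from `b` to `Y` shorter than `t`
    -- vertices, induction with `X = {b}` would contradict its minimality.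
    have hlong : ∀ b ∈ G.core D Y, ∃ y ∈ Y, ∃ q : G.Walk b y, q.IsPath ∧
        (∀ w ∈ q.support, w ∈ G.core D Y) ∧ t ≤ q.length + 1 := by
      intro b hb
      by_contra hcon
      push Not at hcon
      obtain ⟨m, hm⟩ : ∃ m, t = m + 1 := by
        obtain ⟨y, hy⟩ := hY'
        obtain ⟨p, hp⟩ := (linked_core hconn hY ⟨y, hy⟩ hb).reachIn b hb y (subset_core hY hy)
        have := hcon y hy p.bypass p.bypass_isPath
          (fun w hw => hp w (p.support_bypass_subset_support hw))
        exact ⟨t - 1, by omega⟩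
      refine hmin m (by omega) (ih _ hlt (linked_core hconn hY hY' hb) ?_ rfl)
      rintro x rfl y hy p hp hpD
      have := hcon y hy p hp hpD
      omega
    have hcomp : ∀ b ∈ G.core D Y, ∀ v ∈ G.hanging D Y b,
        t < L ∧ G.TreeDepthLE (G.compIn (G.hanging D Y b) v) (L - t) := by
      intro b hb v hv
      have heq : G.compIn (G.hanging D Y b) v = G.compIn (D \ {b}) v := by
        ext w
        refine ⟨fun h => h.mono fun a ha => ⟨ha.1, ha.2.1⟩, fun h => ?_⟩
        exact (ReachIn.inter_compIn h subset_rfl (.refl h.left_mem)).mono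
          fun a ha => hanging_of_reachIn hv ha.2
      rw [heq]
      -- A hanging component is cut off from `Y` by `b`, so linkedness of `D` forces its escape
      -- routes to lead to `X` or to `b`.
      have hlink : G.Linked (G.compIn (D \ {b}) v) (X ∩ G.compIn (D \ {b}) v)
          {u | u ∈ G.compIn (D \ {b}) v ∧ G.Adj u b} := by
        refine linked_compIn hconn hb.1 ⟨hv.1, hv.2.1⟩ ?_ ?_
        · obtain ⟨z, hz, hvz⟩ := hD.exists_reachIn b hb.1 v hv.1 hv.2.1
          rcases hz with hz | hz
          · exact ⟨z, hz, hvz⟩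
          · exact absurd hvz (hv.2.2 z hz)
        · intro d hd u hu hud
          obtain ⟨z, hz, huz⟩ := hD.exists_reachIn d (compIn_subset hd).1 u
            (compIn_subset hu).1 hud
          rcases hz with hz | hz
          · exact .inl ⟨z, hz, huz⟩
          · rcases huz.avoid_or_through b with h | h
            · exact absurd (h.mono (T := D \ {b}) fun a ha => ⟨ha.1.1, ha.2⟩)
                ((hanging_of_reachIn hv hu).2.2 z hz)
            · exact .inr h.1
      obtain ⟨y, hy, q, hq, hqc, hqt⟩ := hlong b hb
      -- A path to a neighbour of `b` continues with the long core path `q`, which uses up `t` of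
      -- the `L` vertices.
      have hpath : ∀ x ∈ X ∩ G.compIn (D \ {b}) v,
          ∀ a ∈ {u | u ∈ G.compIn (D \ {b}) v ∧ G.Adj u b}, ∀ p : G.Walk x a, p.IsPath →
          (∀ w ∈ p.support, w ∈ G.compIn (D \ {b}) v) → p.length + t < L := by
        intro x hx a ha p hp hpD
        have hmem : ∀ w ∈ p.support, w ∈ G.hanging D Y b :=
          fun w hw => hanging_of_reachIn hv (hpD w hw)
        have := hL x hx.1 y hy (p.append (.cons ha.2 q)) (hp.append_cons hq ha.2
          fun w hw hwq => not_mem_hanging_of_mem_core (hqc w hwq) hb.1 (hmem w hw)) ?_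
        · simp only [Walk.length_append, Walk.length_cons] at this
          omega
        · intro w hw
          rw [Walk.support_append, Walk.support_cons, List.tail_cons, List.mem_append] at hw
          rcases hw with hw | hw
          · exact (hmem w hw).1
          · exact (hqc w hw).1
      have htL : t < L := by
        obtain ⟨x, hx⟩ := hlink.left_nonempty
        obtain ⟨a, ha⟩ := hlink.right_nonempty
        obtain ⟨p, hp⟩ := hlink.reachIn x hx.2 a ha.1
        have := hpath x hx a ha p.bypass p.bypass_isPath
          (fun w hw => hp w (p.support_bypass_subset_support hw))
        omega
      refine ⟨htL, ih _ (Set.ncard_lt_ncard (compIn_sdiff_ssubset hb.1)) hlink ?_ rfl⟩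
      intro x hx a ha p hp hpD
      have := hpath x hx a ha p hp hpD
      omega
    have hunion : ⋃ b ∈ G.core D Y, insert b (G.hanging D Y b) = D := by
      ext v
      simp only [Set.mem_iUnion, exists_prop]
      refine ⟨?_, fun hv => exists_core_of_mem hconn hY hY' hv⟩
      rintro ⟨b, hb, rfl | hv⟩
      exacts [hb.1, hv.1]
    have htL : t < L := by
      obtain ⟨b, hb, hv⟩ := exists_core_of_mem hconn hY hY' hv₀
      rcases hv with rfl | hv
      · exact absurd hb hv₀c
      · exact (hcomp b hb v₀ hv).1
    have := hspec.attach (K := G.hanging D Y) (s := L - t)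
      (fun b hb => .of_compIn fun v hv => (hcomp b hb v hv).2) (fun b _ h => h.2.1 rfl) ?_
    · rwa [hunion, Nat.add_sub_cancel' htL.le] at this
    intro b hb b' hb' hbb u hu w hw
    have hw' : w ∉ G.hanging D Y b := by
      rcases hw with rfl | hw
      · exact not_mem_hanging_of_mem_core hb' hb.1
      · exact fun h => hbb (eq_of_mem_hanging hconn hb hb' h hw)
    have hwD : w ∈ D ∧ w ≠ b := by
      rcases hw with rfl | hw
      · exact ⟨hb'.1, hbb.symm⟩
      · exact ⟨hw.1, fun h => not_mem_hanging_of_mem_core hb hb'.1 (h ▸ hw)⟩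
    exact ⟨fun h => hw' (h ▸ hu), fun h => hw' (hanging_of_adj hu h hwD.1 hwD.2)⟩

/-! ### Critical graphs have no cut vertex -/

theorem IsCritical.exists_ne_of_adj {k : ℕ} (h : G.IsCritical k) (hk : 2 ≤ k) {W : Set V}
    (hW : W.Nonempty) :
    ∃ φ : V → Fin (k - 1), ∀ u v, u ∉ W → v ∉ W → G.Adj u v → φ u ≠ φ v := by
  classical
  have hne : (⊤ : G.Subgraph).deleteVerts W ≠ ⊤ := by
    obtain ⟨w, hw⟩ := hW
    intro e
    have : w ∈ ((⊤ : G.Subgraph).deleteVerts W).verts := by rw [e]; trivial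
    rw [Subgraph.deleteVerts_verts] at this
    exact this.2 hw
  obtain ⟨C⟩ := h.1 _ hne
  have hmem : ∀ v, v ∉ W → v ∈ ((⊤ : G.Subgraph).deleteVerts W).verts := by
    intro v hv
    rw [Subgraph.deleteVerts_verts]
    exact ⟨trivial, hv⟩
  refine ⟨fun v => if hv : v ∉ W then C ⟨v, hmem v hv⟩ else ⟨0, by omega⟩,
    fun u v hu hv huv => ?_⟩
  simp only [hu, hv, not_false_eq_true, dif_pos]
  refine C.valid ?_
  simp [Subgraph.coe_adj, hu, hv, huv]

theorem IsCritical.exists_adj_eq {k : ℕ} (h : G.IsCritical k) (φ : V → Fin (k - 1)) :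
    ∃ u v, G.Adj u v ∧ φ u = φ v := by
  by_contra! hcon
  exact h.2 ⟨Coloring.mk φ fun {u v} huv => hcon u v huv⟩

/-- If `d` separated `A` from the rest, colourings of `A ∪ {d}` and of the complement of `A` could
be glued after swapping two colours to make them agree at `d`. -/
theorem IsCritical.reachIn_sdiff_singleton {k : ℕ} (h : G.IsCritical k) (hk : 2 ≤ k) {d u v : V}
    (hu : u ≠ d) (hv : v ≠ d) : G.ReachIn (Set.univ \ {d}) u v := by
  classical
  by_contra hcon
  set A := G.compIn (Set.univ \ {d}) u
  have huA : u ∈ A := .refl ⟨trivial, hu⟩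
  have hvA : v ∉ A := hcon
  have hdA : d ∉ A := fun hd => (compIn_subset hd).2 rfl
  have hout : ∀ x ∈ A, ∀ y ∉ A, G.Adj x y → y = d := by
    intro x hx y hy hxy
    by_contra hyd
    exact hy (ReachIn.trans hx (.cons (compIn_subset hx) hxy (.refl ⟨trivial, hyd⟩)))
  obtain ⟨φ, hφ⟩ := h.exists_ne_of_adj hk (W := A) ⟨u, huA⟩
  obtain ⟨χ, hχ⟩ := h.exists_ne_of_adj hk (W := (insert d A)ᶜ) ⟨v, by simp [hv, hvA]⟩
  have hχA : ∀ x ∈ A, ∀ y ∈ insert d A, G.Adj x y → χ x ≠ χ y :=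
    fun x hx y hy => hχ x y (fun h => h (.inr hx)) (fun h => h hy)
  have hmix : ∀ x ∈ A, ∀ y ∉ A, G.Adj x y → Equiv.swap (χ d) (φ d) (χ x) ≠ φ y := by
    intro x hx y hy hxy
    obtain rfl := hout x hx y hy hxy
    intro e
    exact hχA x hx y (.inl rfl) hxy
      ((Equiv.swap (χ y) (φ y)).injective (e.trans (Equiv.swap_apply_left _ _).symm))
  obtain ⟨x, y, hxy, he⟩ := h.exists_adj_eq
    (fun x => if x ∈ A then Equiv.swap (χ d) (φ d) (χ x) else φ x)
  by_cases hx : x ∈ A <;> by_cases hy : y ∈ A <;> simp only [hx, hy, if_true, if_false] at he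
  · exact hχA x hx y (.inr hy) hxy (Equiv.injective _ he)
  · exact hmix x hx y hy hxy he
  · exact hmix y hy x hx hxy.symm he.symm
  · exact hφ x y hx hy hxy he

/-! ### Counting vertices by treedepth -/

/-- For each vertex `w` let `φ w` be a colouring of `G` with `m` colours that is proper away from
`w`. If `G` is not `m`-colourable, few of these colourings agree on the boundary of a set of small
treedepth that contains their vertices `w`. -/
theorem TreeDepthLE.card_le {m t : ℕ} {D : Set V} (hD : G.TreeDepthLE D t)
    (φ : V → V → Fin m) (hφ : ∀ w u v, u ≠ w → v ≠ w → G.Adj u v → φ w u ≠ φ w v)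
    (hG : ∀ ψ : V → Fin m, ∃ u v, G.Adj u v ∧ ψ u = ψ v) (W : Finset V) (hW : ∀ w ∈ W, w ∈ D)
    (hagree : ∀ w ∈ W, ∀ w' ∈ W, ∀ x ∉ D, (∃ u ∈ D, G.Adj u x) → φ w x = φ w' x) :
    W.card ≤ ∑ i ∈ Finset.range t, m ^ i := by
  classical
  induction hD generalizing W with
  | empty t =>
    have : W = ∅ := Finset.eq_empty_of_forall_notMem hW
    simp [this]
  | @remove D t v hv _ ih =>
    rw [geom_sum_succ]
    -- After deletion `v` may be a boundary vertex, so `W.erase v` is split into `m` classes by the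
    -- colour `φ w v`; `v` itself contributes the extra 1.
    have h1 : (W.erase v).card ≤
        (∑ i ∈ Finset.range t, m ^ i) * (Finset.univ : Finset (Fin m)).card := by
      refine Finset.card_le_mul_card_image_of_maps_to (f := fun w => φ w v) (by simp) _ ?_
      intro c _
      refine ih _ (fun w hw => ?_) (fun w hw w' hw' x hx hux => ?_)
      · simp only [Finset.mem_filter, Finset.mem_erase] at hw
        exact ⟨hW w hw.1.2, hw.1.1⟩
      · simp only [Finset.mem_filter, Finset.mem_erase] at hw hw'
        obtain ⟨u, hu, hux⟩ := hux
        by_cases hxv : x = v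
        · subst hxv; exact hw.2.trans hw'.2.symm
        · exact hagree w hw.1.2 w' hw'.1.2 x (fun h => hx ⟨h, hxv⟩) ⟨u, hu.1, hux⟩
    rw [Finset.card_univ, Fintype.card_fin, mul_comm] at h1
    have := Finset.pred_card_le_card_erase (s := W) (a := v)
    omega
  | @union A B t hd hAB _ _ ihA ihB =>
    -- `φ b` is proper on `A` and `φ a` off `A`; they agree on the outside neighbours of `A`, so
    -- splicing them colours all of `G`.
    have hmix : ∀ a ∈ W, ∀ b ∈ W, a ∈ A → b ∈ B → False := by
      intro a ha b hb haA hbB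
      have hbA : b ∉ A := fun h => Set.disjoint_left.1 hd h hbB
      have hcross : ∀ x ∈ A, ∀ y ∉ A, G.Adj x y → φ b x ≠ φ a y := by
        intro x hx y hy hxy
        have hyB : y ∉ B := fun h => hAB x hx y h hxy
        rw [hagree a ha b hb y (fun h => h.elim hy hyB) ⟨x, .inl hx, hxy⟩]
        exact hφ b x y (fun h => hbA (h ▸ hx)) (fun h => hyB (h ▸ hbB)) hxy
      obtain ⟨x, y, hxy, he⟩ := hG (fun x => if x ∈ A then φ b x else φ a x)
      by_cases hx : x ∈ A <;> by_cases hy : y ∈ A <;> simp only [hx, hy, if_true, if_false] at he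
      · exact hφ b x y (fun h => hbA (h ▸ hx)) (fun h => hbA (h ▸ hy)) hxy he
      · exact hcross x hx y hy hxy he
      · exact hcross y hy x hx hxy.symm he.symm
      · exact hφ a x y (fun h => hx (h ▸ haA)) (fun h => hy (h ▸ haA)) hxy he
    by_cases hWA : ∀ w ∈ W, w ∈ A
    · refine ihA W hWA fun w hw w' hw' x hx ⟨u, hu, hux⟩ => ?_
      exact hagree w hw w' hw' x (fun h => h.elim hx fun h => hAB u hu x h hux) ⟨u, .inl hu, hux⟩
    · push Not at hWA
      obtain ⟨b, hb, hbA⟩ := hWA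
      have hbB := (hW b hb).resolve_left hbA
      refine ihB W (fun w hw => (hW w hw).resolve_left fun h => hmix w hw b hb h hbB)
        fun w hw w' hw' x hx ⟨u, hu, hux⟩ => ?_
      exact hagree w hw w' hw' x (fun h => h.elim (fun h => hAB x h u hu hux.symm) hx)
        ⟨u, .inr hu, hux⟩

theorem IsCritical.card_le [Fintype V] {k t : ℕ} (h : G.IsCritical k) (hk : 2 ≤ k)
    (ht : G.TreeDepthLE Set.univ t) : Fintype.card V ≤ ∑ i ∈ Finset.range t, (k - 1) ^ i := by
  choose φ hφ using fun w : V => h.exists_ne_of_adj hk (W := {w}) ⟨w, rfl⟩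
  exact ht.card_le φ (fun w u v hu hv => hφ w u v hu hv) h.exists_adj_eq Finset.univ
    (fun _ _ => trivial) (fun _ _ _ _ x hx => absurd trivial hx)

/-! ### The long cycle -/

theorem geom_sum_pred_le_pow {k : ℕ} (hk : 1 ≤ k) (t : ℕ) :
    ∑ i ∈ Finset.range t, (k - 1) ^ i ≤ k ^ t := by
  obtain ⟨m, rfl⟩ : ∃ m, k = m + 1 := ⟨k - 1, by omega⟩
  simp only [Nat.add_sub_cancel]
  induction t with
  | zero => simp
  | succ t ih =>
    rw [geom_sum_succ, pow_succ]
    have : 1 ≤ (m + 1) ^ t := Nat.one_le_pow _ _ (by omega)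
    nlinarith

/-- A `k`-critical graph has at most `k ^ l` vertices, where `l` is the length of some cycle. -/
theorem IsCritical.exists_isCycle_card_le_pow [Fintype V] {k : ℕ} (h : G.IsCritical k)
    (hk : 2 ≤ k) (hn : k < Fintype.card V) :
    ∃ (v : V) (c : G.Walk v v), c.IsCycle ∧ Fintype.card V ≤ k ^ c.length := by
  classical
  have hconn : ∀ u ∈ Set.univ, ∀ v ∈ Set.univ, G.ReachIn (Set.univ : Set V) u v := by
    intro u _ v _
    obtain ⟨d, hd⟩ : ∃ d, d ∉ ({u, v} : Finset V) := by
      by_contra! hcon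
      have := (Finset.card_le_card (fun x _ => hcon x : Finset.univ ⊆ ({u, v} : Finset V))).trans
        Finset.card_le_two
      rw [Finset.card_univ] at this
      omega
    simp only [Finset.mem_insert, Finset.mem_singleton, not_or] at hd
    exact (h.reachIn_sdiff_singleton hk (Ne.symm hd.1) (Ne.symm hd.2)).mono Set.sdiff_subset
  obtain ⟨x, y, hxy, -⟩ := h.exists_adj_eq (fun _ => ⟨0, by omega⟩)
  have hlink : G.Linked Set.univ {x} {y} :=
    { left_nonempty := ⟨x, rfl⟩
      right_nonempty := ⟨y, rfl⟩
      left_subset := Set.subset_univ _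
      right_subset := Set.subset_univ _
      reachIn := hconn
      exists_reachIn := by
        intro d _ v _ hvd
        by_cases hxd : x = d
        · exact ⟨y, .inr rfl, h.reachIn_sdiff_singleton hk hvd (fun e => hxy.ne (hxd.trans e.symm))⟩
        · exact ⟨x, .inl rfl, h.reachIn_sdiff_singleton hk hvd hxd⟩ }
  have hlong : ∀ t, ∑ i ∈ Finset.range t, (k - 1) ^ i < Fintype.card V →
      ∃ p : G.Walk x y, p.IsPath ∧ t ≤ p.length := by
    intro t ht
    by_contra! hcon
    refine absurd (h.card_le hk (hlink.treeDepthLE ?_)) (not_le.2 ht)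
    rintro _ rfl _ rfl p hp -
    exact hcon p hp
  have hbdd : ∀ p : G.Walk x y, p.IsPath → p.length < Fintype.card V := fun p hp => hp.length_lt
  obtain ⟨p, hp, hmax⟩ : ∃ p : G.Walk x y, p.IsPath ∧
      ∀ q : G.Walk x y, q.IsPath → q.length ≤ p.length := by
    have hfin : {l | ∃ p : G.Walk x y, p.IsPath ∧ p.length = l}.Finite :=
      (Set.finite_lt_nat (Fintype.card V)).subset (by rintro l ⟨p, hp, rfl⟩; exact hbdd p hp)
    obtain ⟨l, ⟨p, hp, rfl⟩, hl⟩ := Set.exists_max_image _ id hfin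
      (by obtain ⟨p, hp, -⟩ := hlong 0 (by simp; omega); exact ⟨_, p, hp, rfl⟩)
    exact ⟨p, hp, fun q hq => hl _ ⟨q, hq, rfl⟩⟩
  have hp2 : 2 ≤ p.length := by
    -- For `t = 2` the sum is `k`, which is below the order of `G`; length 2 ensures that the path
    -- is not the edge `xy` itself.
    obtain ⟨q, hq, hq2⟩ := hlong 2 (by simp [Finset.sum_range_succ]; omega)
    exact hq2.trans (hmax q hq)
  refine ⟨y, Walk.cons hxy.symm p, ?_, ?_⟩
  · rw [Walk.cons_isCycle_iff]
    refine ⟨hp, fun he => ?_⟩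
    have := hp.length_eq_one_of_mem_edges (Sym2.eq_swap ▸ he)
    omega
  · rw [Walk.length_cons]
    refine le_trans ?_ (geom_sum_pred_le_pow (by omega) _)
    by_contra! hlt
    obtain ⟨q, hq, hql⟩ := hlong _ hlt
    have := hmax q hq
    omega

theorem IsCritical.exists_isCycle_log_le [Fintype V] {k : ℕ} (h : G.IsCritical k)
    (hk : 2 ≤ k) (hn : k < Fintype.card V) :
    ∃ (v : V) (c : G.Walk v v), c.IsCycle ∧
      Real.log (Fintype.card V) / (100 * Real.log k) ≤ (c.length : ℝ) := by
  obtain ⟨v, c, hc, hle⟩ := h.exists_isCycle_card_le_pow hk hn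
  refine ⟨v, c, hc, ?_⟩
  have hk' : 0 < Real.log k := Real.log_pos (by exact_mod_cast hk)
  have hlog : Real.log (Fintype.card V) ≤ c.length * Real.log k := by
    rw [← Real.log_pow]
    exact Real.log_le_log (by exact_mod_cast (by omega : 0 < Fintype.card V)) (by exact_mod_cast hle)
  rw [div_le_iff₀ (by positivity)]
  nlinarith [mul_nonneg (Nat.cast_nonneg (α := ℝ) c.length) hk'.le]

theorem Walk.IsCycle.length_le_circumference {v : V} {c : G.Walk v v} (hc : c.IsCycle) :
    (c.length : ℕ∞) ≤ G.circumference :=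
  le_iSup_of_le v (le_iSup_of_le c (le_iSup_of_le hc le_rfl))

end SimpleGraph

theorem theorem1p1 (k n : ℕ) (hk : 4 ≤ k) (hn : k + 2 ≤ n) :
    (∀ (V : Type*) [Fintype V] (G : SimpleGraph V), Fintype.card V = n → G.IsCritical k →
      ∃ (v : V) (c : G.Walk v v), c.IsCycle ∧
        Real.log n / (100 * Real.log k) ≤ (c.length : ℝ)) ∧
    ((Real.log n / (100 * Real.log k) : ℝ) : EReal) ≤
      ((SimpleGraph.minCriticalCircumference k n : ENNReal) : EReal) := by
  refine ⟨fun V _ G hV hG => ?_, ?_⟩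
  · subst hV
    exact hG.exists_isCycle_log_le (by omega) (by omega)
  · set r := Real.log n / (100 * Real.log k)
    have hle : ((⌈r⌉₊ : ℕ) : ℕ∞) ≤ SimpleGraph.minCriticalCircumference k n := by
      refine le_sSup fun G hG => ?_
      obtain ⟨v, c, hc, hr⟩ := hG.exists_isCycle_log_le (by omega) (by simp; omega)
      rw [Fintype.card_fin] at hr
      exact le_trans (by exact_mod_cast Nat.ceil_le.2 hr) hc.length_le_circumference
    calc (r : EReal) ≤ ((⌈r⌉₊ : ℝ) : EReal) := by exact_mod_cast Nat.le_ceil r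
      _ = (((⌈r⌉₊ : ℕ∞) : ENNReal) : EReal) := by
        rw [ENat.toENNReal_coe]
        exact (EReal.coe_nnreal_eq_coe_real (⌈r⌉₊ : NNReal)).symm
      _ ≤ _ := by
        rw [EReal.coe_ennreal_le_coe_ennreal_iff, ENat.toENNReal_le]
        exact hle
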